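/- Let $(M,g)$ be a smooth $n$-dimensional Riemannian manifold (not assumed complete), with Levi-Civita connection $\nabla$, let $q$ be a smooth $(0,2)$-tensor field on $M$, let $\lambda\in\mathbb{R}$ with $\lambda\neq 0$, and let $f:M\to\mathbb{R}$ be smooth. Let $Q$ denote the $(1,1)$-tensor dual to $q$, i.e. $g(Q(X),Y)=q(X,Y)$, let $\operatorname{tr}(q)=\operatorname{tr}(Q)$ be the trace of $q$ with respect to $g$, and let $(\operatorname{div} q)(X)=\sum_{i=1}^n(\nabla_{e_i}q)(e_i,X)$ for a local orthonormal frame $(e_i)$. Suppose that $(M,g,f)$ is a gradient $q$-soliton, $$\operatorname{Hess} f=\lambda g+\tfrac12 q,$$ that it satisfies the Hamilton type identity $$Q(\nabla f)=\tfrac12\nabla\operatorname{tr}(q),$$ that $\operatorname{tr}(q)$ is constant on $M$, and that $(\operatorname{div} q)(\nabla f)\ge 0$ on $M$. Then: 1. if $\lambda>0$, then $-2\lambda n\le\operatorname{tr}(q)\le 0$; 2. if $\lambda<0$, then $0\le\operatorname{tr}(q)\le-2\lambda n$; 3. if $\operatorname{tr}(q)=0$ on $M$, then $q=0$ (that is,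 $M$ is $q$-flat); 4. if $\operatorname{tr}(q)=-2\lambda n$ on $M$, then $q=-2\lambda g$. -/

import Mathlib

open Bundle Manifold FiberBundle VectorField
open scoped ContDiff

set_option linter.unusedSectionVars false

namespace QSoliton

noncomputable section

variable {E : Type*} [NormedAddCommGroup E] [NormedSpace ℝ E] [FiniteDimensional ℝ E]
  {H : Type*} [TopologicalSpace H] {I : ModelWithCorners ℝ E H}
  {M : Type*} [TopologicalSpace M] [ChartedSpace H M] [IsManifold I ∞ M]
  [RiemannianBundle (fun x : M => TangentSpace I x)]
  [IsContMDiffRiemannianBundle I ∞ E (fun x : M => TangentSpace I x)]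

instance instFiniteDimensionalTangentSpace (x : M) : FiniteDimensional ℝ (TangentSpace I x) :=
  inferInstanceAs (FiniteDimensional ℝ E)

instance instCompleteSpaceTangentSpace (x : M) : CompleteSpace (TangentSpace I x) :=
  FiniteDimensional.complete ℝ _

/-! ### Musical isomorphisms, gradient, trace -/

/-- The `(1,1)`-tensor `B♯` dual to a bilinear form `B` on `T_x M`: `⟪B♯ v, w⟫ = B v w`. -/
def sharp {x : M} (B : TangentSpace I x →L[ℝ] TangentSpace I x →L[ℝ] ℝ) :
    TangentSpace I x →L[ℝ] TangentSpace I x :=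
  InnerProductSpace.continuousLinearMapOfBilin (𝕜 := ℝ) B

theorem inner_sharp {x : M} (B : TangentSpace I x →L[ℝ] TangentSpace I x →L[ℝ] ℝ)
    (v w : TangentSpace I x) : inner ℝ (sharp B v) w = B v w :=
  InnerProductSpace.continuousLinearMapOfBilin_apply (𝕜 := ℝ) B v w

variable (I) in
/-- The gradient `∇f`: `⟪∇f, v⟫ = df(v)`. -/
def grad (f : M → ℝ) (x : M) : TangentSpace I x :=
  (InnerProductSpace.toDual ℝ (TangentSpace I x)).symm (mvfderiv I f x)

theorem inner_grad (f : M → ℝ) (x : M) (v : TangentSpace I x) :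
    inner ℝ (grad I f x) v = mvfderiv I f x v :=
  InnerProductSpace.toDual_symm_apply

/-- The metric trace `tr q = g^{ij} q_{ij}` of a `(0,2)`-tensor, i.e. the trace of the dual
`(1,1)`-tensor. -/
def tr (q : Π x : M, TangentSpace I x →L[ℝ] TangentSpace I x →L[ℝ] ℝ) (x : M) : ℝ :=
  LinearMap.trace ℝ (TangentSpace I x) (sharp (q x)).toLinearMap

/-! ### The Levi-Civita connection -/

variable (I) in
/-- Half the right-hand side of the Koszul formula, i.e. `⟪∇_X Y, Z⟫` at `x`. -/
def koszul (X Y Z : Π x : M, TangentSpace I x) (x : M) : ℝ :=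
  (1 / 2) * (mvfderiv I (fun y => inner ℝ (Y y) (Z y)) x (X x)
    + mvfderiv I (fun y => inner ℝ (Z y) (X y)) x (Y x)
    - mvfderiv I (fun y => inner ℝ (X y) (Y y)) x (Z x)
    + inner ℝ (mlieBracket I X Y x) (Z x)
    - inner ℝ (mlieBracket I Y Z x) (X x)
    + inner ℝ (mlieBracket I Z X x) (Y x))

theorem mdiffAt_inner {x : M} {X Y : Π x : M, TangentSpace I x}
    (hX : MDiffAt (T% X) x) (hY : MDiffAt (T% Y) x) :
    MDiffAt (fun y => inner ℝ (X y) (Y y)) x :=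
  MDifferentiableAt.inner_bundle (IB := I) (F := E) (E := fun x : M => TangentSpace I x) hX hY

theorem koszul_tensorial_left {x : M} {Y Z : Π x : M, TangentSpace I x}
    (hY : MDiffAt (T% Y) x) (hZ : MDiffAt (T% Z) x) :
    TensorialAt I E (koszul I · Y Z x) x where
  smul hf hX := by
    simp [koszul, inner_smul_left, inner_smul_right, inner_add_left,
      mvfderiv_fun_mul hf (mdiffAt_inner hZ hX), mvfderiv_fun_mul hf (mdiffAt_inner hX hY),
      mlieBracket_smul_left hf hX, mlieBracket_smul_right hf hX]
    simp only [real_inner_comm]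
    ring
  add hX hX' := by
    simp [koszul, inner_add_left, inner_add_right,
      mvfderiv_fun_add (mdiffAt_inner hZ hX) (mdiffAt_inner hZ hX'),
      mvfderiv_fun_add (mdiffAt_inner hX hY) (mdiffAt_inner hX' hY),
      mlieBracket_add_left hX hX', mlieBracket_add_right hX hX']
    ring

theorem koszul_tensorial_right {x : M} {X Y : Π x : M, TangentSpace I x}
    (hX : MDiffAt (T% X) x) (hY : MDiffAt (T% Y) x) :
    TensorialAt I E (koszul I X Y · x) x where
  smul hf hZ := by
    simp [koszul, inner_smul_left, inner_smul_right, inner_add_left,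
      mvfderiv_fun_mul hf (mdiffAt_inner hZ hX), mvfderiv_fun_mul hf (mdiffAt_inner hY hZ),
      mlieBracket_smul_left hf hZ, mlieBracket_smul_right hf hZ]
    simp only [real_inner_comm]
    ring
  add hZ hZ' := by
    simp [koszul, inner_add_left, inner_add_right,
      mvfderiv_fun_add (mdiffAt_inner hZ hX) (mdiffAt_inner hZ' hX),
      mvfderiv_fun_add (mdiffAt_inner hY hZ) (mdiffAt_inner hY hZ'),
      mlieBracket_add_left hZ hZ', mlieBracket_add_right hZ hZ']
    ring

open Classical in
/-- The covariant derivative `v ↦ ∇_v Y` at `x`, determined by the Koszul formula when `Y` is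
differentiable at `x` (and `0` otherwise). -/
def leviCivitaFun (Y : Π x : M, TangentSpace I x) (x : M) :
    TangentSpace I x →L[ℝ] TangentSpace I x :=
  if hY : MDiffAt (T% Y) x then
    sharp (TensorialAt.mkHom₂ (fun X Z => koszul I X Y Z x) x
      (fun _ hZ => koszul_tensorial_left hY hZ) (fun _ hX => koszul_tensorial_right hX hY))
  else 0

theorem inner_leviCivitaFun {x : M} {X Y Z : Π x : M, TangentSpace I x}
    (hX : MDiffAt (T% X) x) (hY : MDiffAt (T% Y) x) (hZ : MDiffAt (T% Z) x) :
    inner ℝ (leviCivitaFun Y x (X x)) (Z x) = koszul I X Y Z x := by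
  rw [leviCivitaFun, dif_pos hY, inner_sharp]
  exact TensorialAt.mkHom₂_apply (Φ := fun X Z => koszul I X Y Z x) _ _ hX hZ

theorem leviCivitaFun_eq_of_koszul {x : M} {Y : Π x : M, TangentSpace I x}
    (hY : MDiffAt (T% Y) x) (L : TangentSpace I x →L[ℝ] TangentSpace I x)
    (h : ∀ X Z : Π x : M, TangentSpace I x, MDiffAt (T% X) x → MDiffAt (T% Z) x →
      koszul I X Y Z x = inner ℝ (L (X x)) (Z x)) :
    leviCivitaFun Y x = L := by
  ext v
  refine ext_inner_right ℝ fun w => ?_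
  have hv : MDiffAt (T% (extend E v)) x := mdifferentiableAt_extend ..
  have hw : MDiffAt (T% (extend E w)) x := mdifferentiableAt_extend ..
  have h1 := inner_leviCivitaFun hv hY hw
  rw [h _ _ hv hw] at h1
  simpa using h1

variable (I M) in
/-- The Levi-Civita connection of the Riemannian metric; `leviCivita I M Y x v` is `∇_v Y` at `x`.-/
def leviCivita : CovariantDerivative I E (fun x : M => TangentSpace I x) where
  toFun := leviCivitaFun
  isCovariantDerivativeOnUniv :=
    { add := by
        intro Y Y' x hY hY' _
        refine leviCivitaFun_eq_of_koszul (mdifferentiableAt_add_section hY hY') _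
          fun X Z hX hZ => ?_
        simp [inner_add_left, inner_leviCivitaFun hX hY hZ, inner_leviCivitaFun hX hY' hZ]
        simp [koszul, inner_add_left, inner_add_right,
          mvfderiv_fun_add (mdiffAt_inner hY hZ) (mdiffAt_inner hY' hZ),
          mvfderiv_fun_add (mdiffAt_inner hX hY) (mdiffAt_inner hX hY'),
          mlieBracket_add_left hY hY', mlieBracket_add_right hY hY']
        ring
      leibniz := by
        intro Y g x hY hg _
        refine leviCivitaFun_eq_of_koszul (hg.smul_section hY) _ fun X Z hX hZ => ?_
        simp [inner_add_left, inner_smul_left, inner_leviCivitaFun hX hY hZ]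
        simp [koszul, inner_smul_left, inner_smul_right, inner_add_left,
          mvfderiv_fun_mul hg (mdiffAt_inner hY hZ), mvfderiv_fun_mul hg (mdiffAt_inner hX hY),
          mlieBracket_smul_left hg hY, mlieBracket_smul_right hg hY]
        simp only [real_inner_comm]
        ring }

/-- `leviCivita` is compatible with the metric. -/
theorem leviCivita_metric {x : M} {X Y Z : Π x : M, TangentSpace I x}
    (hX : MDiffAt (T% X) x) (hY : MDiffAt (T% Y) x) (hZ : MDiffAt (T% Z) x) :
    mvfderiv I (fun y => inner ℝ (Y y) (Z y)) x (X x) =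
      inner ℝ (leviCivita I M Y x (X x)) (Z x) + inner ℝ (Y x) (leviCivita I M Z x (X x)) := by
  rw [real_inner_comm _ (Y x)]
  change _ = inner ℝ (leviCivitaFun Y x (X x)) (Z x) + inner ℝ (leviCivitaFun Z x (X x)) (Y x)
  rw [inner_leviCivitaFun hX hY hZ, inner_leviCivitaFun hX hZ hY, koszul, koszul,
    mlieBracket_swap_apply (V := X) (W := Z), mlieBracket_swap_apply (V := Y) (W := Z),
    mlieBracket_swap_apply (V := Y) (W := X)]
  simp only [real_inner_comm, inner_neg_left]
  ring

/-- `leviCivita` is torsion-free. -/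
theorem leviCivita_torsion {x : M} {X Y : Π x : M, TangentSpace I x}
    (hX : MDiffAt (T% X) x) (hY : MDiffAt (T% Y) x) :
    leviCivita I M Y x (X x) - leviCivita I M X x (Y x) = mlieBracket I X Y x := by
  refine ext_inner_right ℝ fun w => ?_
  have hw : MDiffAt (T% (extend E w)) x := mdifferentiableAt_extend ..
  have h1 := inner_leviCivitaFun hX hY hw
  have h2 := inner_leviCivitaFun hY hX hw
  rw [extend_apply_self] at h1 h2
  rw [inner_sub_left]
  change inner ℝ (leviCivitaFun Y x (X x)) w - inner ℝ (leviCivitaFun X x (Y x)) w = _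
  rw [h1, h2, koszul, koszul,
    mlieBracket_swap_apply (V := Y) (W := X), mlieBracket_swap_apply (V := extend E w) (W := X),
    mlieBracket_swap_apply (V := extend E w) (W := Y)]
  simp only [real_inner_comm, inner_neg_left, extend_apply_self]
  ring

/-! ### Hessian and divergence -/

/-- The Hessian `Hess f (v, w) = ⟪∇_v ∇f, w⟫`. -/
def hessian (f : M → ℝ) (x : M) (v w : TangentSpace I x) : ℝ :=
  inner ℝ (leviCivita I M (grad I f) x v) w

/-- Smoothness of a `(0,2)`-tensor field. -/
def IsSmoothTensor (q : Π x : M, TangentSpace I x →L[ℝ] TangentSpace I x →L[ℝ] ℝ) : Prop :=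
  ContMDiff I (I.prod 𝓘(ℝ, E →L[ℝ] E →L[ℝ] ℝ)) ∞
    (fun x => TotalSpace.mk' (E →L[ℝ] E →L[ℝ] ℝ)
      (E := fun x : M => TangentSpace I x →L[ℝ] TangentSpace I x →L[ℝ] ℝ) x (q x))

/-- For a `(0,2)`-tensor field `q`, the expression
`(∇_u q)(V, W) = u(q(V, W)) - q(∇_u V, W) - q(V, ∇_u W)` at `x`, for vector fields `V`, `W`. -/
def covDerivAux (q : Π x : M, TangentSpace I x →L[ℝ] TangentSpace I x →L[ℝ] ℝ)
    (x : M) (u : TangentSpace I x) (V W : Π x : M, TangentSpace I x) : ℝ :=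
  mvfderiv I (fun y => q y (V y) (W y)) x u
    - q x (leviCivita I M V x u) (W x) - q x (V x) (leviCivita I M W x u)

/-- The covariant derivative `(∇_u q)(v, w)` of a `(0,2)`-tensor field: extend `v`, `w` to
vector fields near `x`; the value does not depend on the extension, see `covDeriv_apply`. -/
def covDeriv (q : Π x : M, TangentSpace I x →L[ℝ] TangentSpace I x →L[ℝ] ℝ)
    (x : M) (u v w : TangentSpace I x) : ℝ :=
  covDerivAux q x u (extend E v) (extend E w)

theorem mdiffAt_tensor {q : Π x : M, TangentSpace I x →L[ℝ] TangentSpace I x →L[ℝ] ℝ}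
    (hq : IsSmoothTensor q) {x : M} {V W : Π x : M, TangentSpace I x}
    (hV : MDiffAt (T% V) x) (hW : MDiffAt (T% W) x) :
    MDiffAt (fun y => q y (V y) (W y)) x := by
  have hq' := (hq.contMDiffAt (x := x)).mdifferentiableAt (by simp)
  have h : MDifferentiableAt I (I.prod 𝓘(ℝ)) (fun y =>
      TotalSpace.mk' ℝ (E := Bundle.Trivial M ℝ) y (q y (V y) (W y))) x :=
    MDifferentiableAt.clm_bundle_apply₂ (F₁ := E) (F₂ := E) hq' hV hW
  simp only [mdifferentiableAt_totalSpace] at h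
  exact h.2

theorem covDeriv_apply {q : Π x : M, TangentSpace I x →L[ℝ] TangentSpace I x →L[ℝ] ℝ}
    (hq : IsSmoothTensor q) {x : M} (u : TangentSpace I x) {V W : Π x : M, TangentSpace I x}
    (hV : MDiffAt (T% V) x) (hW : MDiffAt (T% W) x) :
    covDeriv q x u (V x) (W x) = covDerivAux q x u V W := by
  refine TensorialAt.pointwise₂ (I := I) (F := E) (F' := E) (Φ := covDerivAux q x u) ?_ ?_
    (mdifferentiableAt_extend ..) hV (mdifferentiableAt_extend ..) hW (by simp) (by simp)
  · intro W hW
    constructor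
    · intro g V hg hV
      simp [covDerivAux, (leviCivita I M).isCovariantDerivativeOnUniv.leibniz hV hg,
        mvfderiv_fun_mul hg (mdiffAt_tensor hq hV hW)]
      ring
    · intro V V' hV hV'
      simp [covDerivAux, (leviCivita I M).isCovariantDerivativeOnUniv.add hV hV',
        mvfderiv_fun_add (mdiffAt_tensor hq hV hW) (mdiffAt_tensor hq hV' hW)]
      ring
  · intro V hV
    constructor
    · intro g W hg hW
      simp [covDerivAux, (leviCivita I M).isCovariantDerivativeOnUniv.leibniz hW hg,
        mvfderiv_fun_mul hg (mdiffAt_tensor hq hV hW)]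
      ring
    · intro W W' hW hW'
      simp [covDerivAux, (leviCivita I M).isCovariantDerivativeOnUniv.add hW hW',
        mvfderiv_fun_add (mdiffAt_tensor hq hV hW) (mdiffAt_tensor hq hV hW')]
      ring

/-- The divergence `(div q)(w) = ∑ᵢ (∇_{eᵢ} q)(eᵢ, w)`, with `(eᵢ)` an orthonormal basis of
`T_x M`; in coordinates `(div q)_l = g^{ij} ∇_i q_{jl}`. -/
def div (q : Π x : M, TangentSpace I x →L[ℝ] TangentSpace I x →L[ℝ] ℝ)
    (x : M) (w : TangentSpace I x) : ℝ :=
  ∑ i, covDeriv q x (stdOrthonormalBasis ℝ (TangentSpace I x) i)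
    (stdOrthonormalBasis ℝ (TangentSpace I x) i) w

/-! ### Gradient solitons -/

/-- `(M, g, f)` is a gradient `q`-soliton with constant `lam`: `Hess f = lam g + (1/2) q`, with
`f` and `q` smooth. -/
structure IsGradientSoliton
    (q : Π x : M, TangentSpace I x →L[ℝ] TangentSpace I x →L[ℝ] ℝ) (lam : ℝ) (f : M → ℝ) :
    Prop where
  smooth_tensor : IsSmoothTensor q
  smooth_potential : ContMDiff I 𝓘(ℝ) ∞ f
  hessian_eq : ∀ (x : M) (v w : TangentSpace I x),
    hessian f x v w = lam * inner ℝ v w + (1 / 2) * q x v w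

/-- The Hamilton type identity `Q(∇f) = (1/2) ∇ tr(q)`, with `Q` the `(1,1)`-tensor dual
to `q`. -/
def HamiltonIdentity
    (q : Π x : M, TangentSpace I x →L[ℝ] TangentSpace I x →L[ℝ] ℝ) (f : M → ℝ) : Prop :=
  ∀ x : M, sharp (q x) (grad I f x) = (1 / 2 : ℝ) • grad I (tr q) x

end

end QSoliton

/-!
Write `Q` for `sharp q`. Since `tr q` is constant, the Hamilton identity says `Q(∇f) = 0`, that is
`q(∇f, ·) = 0`. The Hessian of a smooth function is symmetric, hence so is `q = 2 (Hess f - lam g)`,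
and therefore `q(·, ∇f) = 0` as well. Expanding `(∇_{eᵢ} q)(eᵢ, ∇f)` by the Leibniz rule, only the
term `-q(eᵢ, ∇_{eᵢ} ∇f)` survives, and `∇_{eᵢ} ∇f = lam eᵢ + (1/2) Q eᵢ` by the soliton equation, so
`(div q)(∇f) = -(lam tr q + (1/2) |Q|²)` (`IsGradientSoliton.div_grad`). The hypothesis on the
divergence becomes the pointwise inequality `|Q|² ≤ -2 lam tr q`.

All four conclusions follow from it by looking at the two squared norms `|Q|²` and
`|Q + 2 lam id|² = |Q|² + 4 lam tr q + 4 lam² n` (`sum_norm_sharp_sub_sq`). Their nonnegativity gives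
`lam tr q ≤ 0` and `lam (tr q + 2 lam n) ≥ 0`; in the two rigidity cases the first, respectively the
second, of them is at most `0`, hence vanishes.

Two facts of Riemannian geometry have to be supplied. The gradient of a smooth function is a smooth
vector field (`contMDiff_grad`): in a local frame its coefficients are the inverse Gram matrix
applied to the derivatives of `f` along the frame. The Lie bracket acts on functions as the
commutator of derivations (`mvfderiv_mlieBracket`), which gives the symmetry of the Hessian
(`hessian_symm`).
-/

namespace QSoliton

open Filter Topology

/-! ### Smooth dependence of the solution of a linear system -/

theorem contDiff_matrix_det {ι : Type*} [Fintype ι] [DecidableEq ι] :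
    ContDiff ℝ ∞ (fun A : ι → ι → ℝ => (Matrix.of A).det) := by
  simp only [Matrix.det_apply, Matrix.of_apply]
  fun_prop

theorem contDiffAt_matrix_inv_mulVec {ι : Type*} [Fintype ι] [DecidableEq ι] (i : ι)
    {p : (ι → ι → ℝ) × (ι → ℝ)} (hp : (Matrix.of p.1).det ≠ 0) :
    ContDiffAt ℝ ∞ (fun p : (ι → ι → ℝ) × (ι → ℝ) =>
      ((Matrix.of p.1)⁻¹.mulVec p.2) i) p := by
  have hdet : ContDiffAt ℝ ∞ (fun p : (ι → ι → ℝ) × (ι → ℝ) => (Matrix.of p.1).det) p :=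
    (contDiff_matrix_det.comp contDiff_fst).contDiffAt
  have hadj : ∀ j, ContDiffAt ℝ ∞
      (fun p : (ι → ι → ℝ) × (ι → ℝ) => (Matrix.of p.1).adjugate i j) p := fun j => by
    simp only [Matrix.adjugate_apply]
    have hrow : ContDiff ℝ ∞ (fun p : (ι → ι → ℝ) × (ι → ℝ) =>
        (fun k l => (Matrix.of p.1).updateRow j (Pi.single i 1) k l : ι → ι → ℝ)) := by
      refine contDiff_pi.2 fun k => contDiff_pi.2 fun l => ?_
      by_cases hk : k = j
      · simp only [Matrix.updateRow_apply, hk, if_true]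
        exact contDiff_const
      · simp only [Matrix.updateRow_apply, hk, if_false, Matrix.of_apply]
        fun_prop
    exact (contDiff_matrix_det.comp hrow).contDiffAt
  simp only [Matrix.inv_def, Matrix.mulVec, dotProduct, Matrix.smul_apply, Ring.inverse_eq_inv',
    smul_eq_mul]
  refine ContDiffAt.sum fun j _ => ((hdet.inv hp).mul (hadj j)).mul ?_
  fun_prop

variable {E : Type*} [NormedAddCommGroup E] [NormedSpace ℝ E] [FiniteDimensional ℝ E]
  {H : Type*} [TopologicalSpace H] {I : ModelWithCorners ℝ E H}
  {M : Type*} [TopologicalSpace M] [ChartedSpace H M] [IsManifold I ∞ M]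

/-! ### Vector fields as derivations -/

theorem contMDiffAt_mvfderiv_apply {f : M → ℝ} (hf : ContMDiff I 𝓘(ℝ) ∞ f) {x : M}
    {V : Π x : M, TangentSpace I x} (hV : CMDiffAt ∞ (T% V) x) :
    CMDiffAt ∞ (fun y => mvfderiv I f y (V y)) x := by
  have h := (hf.contMDiff_tangentMap (m := ∞) (by simp)).contMDiffAt.comp x hV
  rw [contMDiffAt_totalSpace] at h
  have h2 := h.2
  simp only [trivializationAt_model_space_apply] at h2
  exact h2

/-- `[U, V] f = U (V f) - V (U f)`. This is obtained without coordinates, by expanding the Jacobi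
identity for `U`, `V`, `f W` with the product rule for the bracket and subtracting `f` times the
Jacobi identity for `U`, `V`, `W`: what is left is the claimed identity times `W`. -/
theorem mvfderiv_mlieBracket {f : M → ℝ} (hf : ContMDiff I 𝓘(ℝ) ∞ f) {x : M}
    {U V : Π x : M, TangentSpace I x} (hU : CMDiffAt ∞ (T% U) x) (hV : CMDiffAt ∞ (T% V) x) :
    mvfderiv I f x (mlieBracket I U V x) =
      mvfderiv I (fun y => mvfderiv I f y (V y)) x (U x) -
        mvfderiv I (fun y => mvfderiv I f y (U y)) x (V x) := by
  -- The field `W` has to be nonzero at `x`; if there is no such field, both sides vanish.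
  by_cases htriv : ∀ w : TangentSpace I x, w = 0
  · simp [htriv (U x), htriv (V x), htriv (mlieBracket I U V x)]
  push Not at htriv
  obtain ⟨w, hw⟩ := htriv
  have h3 : minSmoothness ℝ 3 ≤ ∞ := by
    rw [minSmoothness_of_isRCLikeNormedField]; exact ENat.LEInfty.out
  have h23 : minSmoothness ℝ 2 ≤ minSmoothness ℝ 3 := minSmoothness_monotone (by norm_num)
  have : IsManifold I (minSmoothness ℝ 3) M := .of_le h3
  have : IsManifold I (minSmoothness ℝ 2) M := .of_le (h23.trans h3)
  have : IsManifold I (∞ + 1) M := by simpa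
  set W : Π x : M, TangentSpace I x := extend E w with hWdef
  have hW : CMDiffAt ∞ (T% W) x := contMDiffAt_extend ..
  have hWx : W x = w := extend_apply_self ..
  have hf' : ∀ y, MDiffAt f y := hf.mdifferentiable (by simp)
  have hbr : ∀ X Y : Π x : M, TangentSpace I x, CMDiffAt ∞ (T% X) x → CMDiffAt ∞ (T% Y) x →
      CMDiffAt ∞ (T% (mlieBracket I X Y)) x := fun X Y hX hY =>
    hX.mlieBracket_vectorField (m := ⊤) (n := ⊤) hY (by simp)
  have h2 : ∀ {X : Π x : M, TangentSpace I x}, CMDiffAt ∞ (T% X) x →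
      CMDiffAt (minSmoothness ℝ 2) (T% X) x := fun hX => hX.of_le (h23.trans h3)
  have hd : ∀ {X : Π x : M, TangentSpace I x}, CMDiffAt ∞ (T% X) x → MDiffAt (T% X) x :=
    fun hX => hX.mdifferentiableAt (by simp)
  have hWev : ∀ᶠ y in 𝓝 x, MDiffAt (T% W) y := by
    filter_upwards [contMDiffAt_iff_contMDiffAt_nhds (n := 1) (by simp) |>.1
      (hW.of_le (by simp))] with y hy
    exact hy.mdifferentiableAt (by simp)
  have hfW : ∀ X : Π x : M, TangentSpace I x,
      mlieBracket I X (f • W) =ᶠ[𝓝 x]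
        (fun y => mvfderiv I f y (X y)) • W + f • mlieBracket I X W := fun X => by
    filter_upwards [hWev] with y hy
    exact mlieBracket_smul_right (hf' y) hy
  have expand : ∀ X Y : Π x : M, TangentSpace I x, CMDiffAt ∞ (T% X) x → CMDiffAt ∞ (T% Y) x →
      mlieBracket I X (mlieBracket I Y (f • W)) x =
        (mvfderiv I (fun y => mvfderiv I f y (Y y)) x (X x) • W x +
          mvfderiv I f x (Y x) • mlieBracket I X W x) +
        (mvfderiv I f x (X x) • mlieBracket I Y W x +
          f x • mlieBracket I X (mlieBracket I Y W) x) := fun X Y hX hY => by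
    have hYf := (contMDiffAt_mvfderiv_apply hf hY).mdifferentiableAt (by simp)
    rw [(EventuallyEq.refl _ X).mlieBracket_vectorField_eq (hfW Y),
      mlieBracket_add_right (hYf.smul_section (hd hW))
        ((hf' x).smul_section (hd (hbr Y W hY hW))),
      mlieBracket_smul_right hYf (hd hW), mlieBracket_smul_right (hf' x) (hd (hbr Y W hY hW))]
  have J1 := leibniz_identity_mlieBracket_apply (h2 hU) (h2 hV)
    (h2 (hf.contMDiffAt.smul_section hW))
  have J2 := leibniz_identity_mlieBracket_apply (h2 hU) (h2 hV) (h2 hW)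
  rw [expand U V hU hV, expand V U hV hU, mlieBracket_smul_right (hf' x) (hd hW)] at J1
  have key : (mvfderiv I f x (mlieBracket I U V x) -
      (mvfderiv I (fun y => mvfderiv I f y (V y)) x (U x) -
        mvfderiv I (fun y => mvfderiv I f y (U y)) x (V x))) • W x = 0 := by
    linear_combination (norm := module) f x • J2 - J1
  rw [hWx] at key
  exact sub_eq_zero.1 ((smul_eq_zero.1 key).resolve_right hw)

variable
  [RiemannianBundle (fun x : M => TangentSpace I x)]
  [IsContMDiffRiemannianBundle I ∞ E (fun x : M => TangentSpace I x)]

/-! ### The gradient and the Hessian -/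

theorem contMDiff_grad {f : M → ℝ} (hf : ContMDiff I 𝓘(ℝ) ∞ f) :
    ContMDiff I I.tangent ∞ (T% (grad I f)) := by
  classical
  intro x
  set b := Module.finBasis ℝ E
  set e := trivializationAt E (TangentSpace I : M → Type _) x with he
  have hx : x ∈ e.baseSet := mem_baseSet_trivializationAt ..
  have hfr := e.isLocalFrameOn_localFrame_baseSet I ∞ b
  have hs : ∀ i, CMDiffAt ∞ (T% (e.localFrame b i)) x := fun i =>
    hfr.contMDiffAt e.open_baseSet hx i
  -- Gram matrix of the frame, and derivatives of `f` along it.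
  set A : M → Fin (Module.finrank ℝ E) → Fin (Module.finrank ℝ E) → ℝ :=
    fun y i j => inner ℝ (e.localFrame b i y) (e.localFrame b j y)
  set B : M → Fin (Module.finrank ℝ E) → ℝ :=
    fun y i => mvfderiv I f y (e.localFrame b i y)
  have hA : ContMDiffAt I 𝓘(ℝ, Fin (Module.finrank ℝ E) → Fin (Module.finrank ℝ E) → ℝ) ∞ A x :=
    contMDiffAt_pi_space.2 fun i => contMDiffAt_pi_space.2 fun j =>
    ContMDiffAt.inner_bundle (IB := I) (F := E) (E := fun x : M => TangentSpace I x) (hs i) (hs j)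
  have hB : ContMDiffAt I 𝓘(ℝ, Fin (Module.finrank ℝ E) → ℝ) ∞ B x :=
    contMDiffAt_pi_space.2 fun i => contMDiffAt_mvfderiv_apply hf (hs i)
  have hdet : ∀ y ∈ e.baseSet, (Matrix.of (A y)).det ≠ 0 := fun y hy => by
    have h := (Matrix.posDef_gram_of_linearIndependent (𝕜 := ℝ) (hfr.linearIndependent hy)).det_pos
    exact h.ne'
  have hcoeff : ∀ i, ∀ y ∈ e.baseSet, hfr.coeff i y (grad I f y) =
      ((Matrix.of (A y))⁻¹.mulVec (B y)) i := fun i y hy => by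
    have hsum := hfr.coeff_sum_eq (grad I f) hy
    have hmul : (Matrix.of (A y)).mulVec (fun j => hfr.coeff j y (grad I f y)) = B y := by
      funext k
      have := congrArg (fun v => inner ℝ v (e.localFrame b k y)) hsum
      simp only [inner_grad, sum_inner, inner_smul_left] at this
      simp only [Matrix.mulVec, dotProduct, Matrix.of_apply, A, B]
      rw [this]
      refine Finset.sum_congr rfl fun j _ => ?_
      rw [real_inner_comm, mul_comm]
      rfl
    rw [← hmul, Matrix.mulVec_mulVec, Matrix.nonsing_inv_mul _ (hdet y hy).isUnit,
      Matrix.one_mulVec]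
  refine hfr.contMDiffAt_of_coeff (fun i => ?_) (e.open_baseSet.mem_nhds hx)
  have := ContMDiffAt.comp (f := fun y => (A y, B y)) x
    (contDiffAt_matrix_inv_mulVec i (p := (A x, B x)) (hdet x hx)).contMDiffAt
    (hA.prodMk_space hB)
  refine this.congr_of_eventuallyEq ?_
  filter_upwards [e.open_baseSet.mem_nhds hx] with y hy
  exact hcoeff i y hy

theorem mdifferentiableAt_grad {f : M → ℝ} (hf : ContMDiff I 𝓘(ℝ) ∞ f) (x : M) :
    MDiffAt (T% (grad I f)) x :=
  (contMDiff_grad hf).mdifferentiable (by simp) x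

theorem hessian_apply {f : M → ℝ} (hf : ContMDiff I 𝓘(ℝ) ∞ f) {x : M}
    {V W : Π x : M, TangentSpace I x} (hV : MDiffAt (T% V) x) (hW : MDiffAt (T% W) x) :
    hessian f x (V x) (W x) = mvfderiv I (fun y => mvfderiv I f y (W y)) x (V x) -
      mvfderiv I f x (leviCivita I M W x (V x)) := by
  have h := leviCivita_metric hV (mdifferentiableAt_grad hf x) hW
  simp only [inner_grad] at h
  rw [hessian, h, add_sub_cancel_right]

theorem hessian_symm {f : M → ℝ} (hf : ContMDiff I 𝓘(ℝ) ∞ f) (x : M) (v w : TangentSpace I x) :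
    hessian f x v w = hessian f x w v := by
  have hv : CMDiffAt ∞ (T% (extend E v)) x := contMDiffAt_extend ..
  have hw : CMDiffAt ∞ (T% (extend E w)) x := contMDiffAt_extend ..
  have hv' := hv.mdifferentiableAt (by simp)
  have hw' := hw.mdifferentiableAt (by simp)
  have h1 := hessian_apply hf hv' hw'
  have h2 := hessian_apply hf hw' hv'
  have h3 := mvfderiv_mlieBracket hf hv hw
  rw [← leviCivita_torsion hv' hw', map_sub] at h3
  simp only [extend_apply_self] at h1 h2 h3
  rw [h1, h2]
  linarith

/-! ### Gradient solitons -/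

theorem IsGradientSoliton.tensor_symm
    {q : Π x : M, TangentSpace I x →L[ℝ] TangentSpace I x →L[ℝ] ℝ} {lam : ℝ} {f : M → ℝ}
    (h : IsGradientSoliton q lam f) (x : M) (v w : TangentSpace I x) : q x v w = q x w v := by
  have h1 := h.hessian_eq x v w
  have h2 := h.hessian_eq x w v
  rw [hessian_symm h.smooth_potential, real_inner_comm] at h1
  linarith

theorem IsGradientSoliton.leviCivita_grad
    {q : Π x : M, TangentSpace I x →L[ℝ] TangentSpace I x →L[ℝ] ℝ} {lam : ℝ} {f : M → ℝ}
    (h : IsGradientSoliton q lam f) (x : M) (v : TangentSpace I x) :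
    leviCivita I M (grad I f) x v = lam • v + (1 / 2 : ℝ) • sharp (q x) v := by
  refine ext_inner_right ℝ fun w => ?_
  rw [inner_add_left, real_inner_smul_left, real_inner_smul_left, inner_sharp]
  exact h.hessian_eq x v w

theorem HamiltonIdentity.apply_grad_eq_zero
    {q : Π x : M, TangentSpace I x →L[ℝ] TangentSpace I x →L[ℝ] ℝ} {f : M → ℝ}
    (h : HamiltonIdentity q f) (htr : ∀ x y, tr q x = tr q y) (x : M) (w : TangentSpace I x) :
    q x (grad I f x) w = 0 := by
  have hconst : tr q = fun _ => tr q x := funext fun y => htr y x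
  rw [← inner_sharp, h x, real_inner_smul_left, inner_grad, hconst, mvfderiv_const]
  simp

/-! ### Divergence, trace and norm -/

theorem div_apply_of_apply_eq_zero
    {q : Π x : M, TangentSpace I x →L[ℝ] TangentSpace I x →L[ℝ] ℝ} (hq : IsSmoothTensor q)
    {x : M} {W : Π x : M, TangentSpace I x} (hW : MDiffAt (T% W) x)
    (h0 : ∀ (y : M) (v : TangentSpace I y), q y v (W y) = 0) :
    div q x (W x) = -∑ i, q x (stdOrthonormalBasis ℝ (TangentSpace I x) i)
      (leviCivita I M W x (stdOrthonormalBasis ℝ (TangentSpace I x) i)) := by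
  rw [div, ← Finset.sum_neg_distrib]
  refine Finset.sum_congr rfl fun i _ => ?_
  set e := stdOrthonormalBasis ℝ (TangentSpace I x) i
  have h := covDeriv_apply hq e
    (mdifferentiableAt_extend (I := I) (F := E) (V := fun x : M => TangentSpace I x) e) hW
  rw [extend_apply_self] at h
  rw [h, covDerivAux, extend_apply_self, h0]
  simp [h0, mvfderiv_const]

theorem tr_eq_sum (q : Π x : M, TangentSpace I x →L[ℝ] TangentSpace I x →L[ℝ] ℝ) (x : M) :
    tr q x = ∑ i, inner ℝ (sharp (q x) (stdOrthonormalBasis ℝ (TangentSpace I x) i))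
      (stdOrthonormalBasis ℝ (TangentSpace I x) i) := by
  rw [tr, LinearMap.trace_eq_sum_inner _ (stdOrthonormalBasis ℝ (TangentSpace I x))]
  exact Finset.sum_congr rfl fun i _ => real_inner_comm _ _

/-- The squared Hilbert-Schmidt norm: `|Q - c id|² = |Q|² - 2 c tr q + c² dim M`. -/
theorem sum_norm_sharp_sub_sq
    (q : Π x : M, TangentSpace I x →L[ℝ] TangentSpace I x →L[ℝ] ℝ) (x : M) (c : ℝ) :
    ∑ i, ‖sharp (q x) (stdOrthonormalBasis ℝ (TangentSpace I x) i) -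
        c • stdOrthonormalBasis ℝ (TangentSpace I x) i‖ ^ 2 =
      ∑ i, ‖sharp (q x) (stdOrthonormalBasis ℝ (TangentSpace I x) i)‖ ^ 2 -
        2 * c * tr q x + c ^ 2 * Module.finrank ℝ E := by
  have hterm : ∀ i, ‖sharp (q x) (stdOrthonormalBasis ℝ (TangentSpace I x) i) -
        c • stdOrthonormalBasis ℝ (TangentSpace I x) i‖ ^ 2 =
      ‖sharp (q x) (stdOrthonormalBasis ℝ (TangentSpace I x) i)‖ ^ 2 -
        2 * c * inner ℝ (sharp (q x) (stdOrthonormalBasis ℝ (TangentSpace I x) i))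
          (stdOrthonormalBasis ℝ (TangentSpace I x) i) + c ^ 2 := fun i => by
    rw [norm_sub_sq_real, norm_smul, real_inner_smul_right, OrthonormalBasis.norm_eq_one,
      mul_one, Real.norm_eq_abs, sq_abs]
    ring
  rw [Finset.sum_congr rfl fun i _ => hterm i, Finset.sum_add_distrib, Finset.sum_sub_distrib,
    ← Finset.mul_sum, ← tr_eq_sum, Finset.sum_const, Finset.card_univ, Fintype.card_fin,
    nsmul_eq_mul, mul_comm (c ^ 2)]
  rfl

theorem eq_smul_inner_of_sum_norm_sq_nonpos
    {q : Π x : M, TangentSpace I x →L[ℝ] TangentSpace I x →L[ℝ] ℝ} {x : M} {c : ℝ}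
    (h : ∑ i, ‖sharp (q x) (stdOrthonormalBasis ℝ (TangentSpace I x) i) -
        c • stdOrthonormalBasis ℝ (TangentSpace I x) i‖ ^ 2 ≤ 0) (v w : TangentSpace I x) :
    q x v w = c * inner ℝ v w := by
  have h0 := (Finset.sum_eq_zero_iff_of_nonneg fun i _ => by positivity).1
    (h.antisymm (Finset.sum_nonneg fun i _ => by positivity))
  have hQ : (sharp (q x)).toLinearMap = c • LinearMap.id := by
    refine (stdOrthonormalBasis ℝ (TangentSpace I x)).toBasis.ext fun i => ?_
    have := h0 i (Finset.mem_univ i)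
    rw [sq_eq_zero_iff, norm_eq_zero, sub_eq_zero] at this
    simpa using this
  have hv : sharp (q x) v = c • v := congrArg (fun L => L v) hQ
  rw [← inner_sharp, hv, real_inner_smul_left]

/-! ### The divergence in the direction of the gradient -/

theorem IsGradientSoliton.div_grad
    {q : Π x : M, TangentSpace I x →L[ℝ] TangentSpace I x →L[ℝ] ℝ} {lam : ℝ} {f : M → ℝ}
    (h : IsGradientSoliton q lam f) (hH : HamiltonIdentity q f) (htr : ∀ x y, tr q x = tr q y)
    (x : M) :
    div q x (grad I f x) = -(lam * tr q x +
      1 / 2 * ∑ i, ‖sharp (q x) (stdOrthonormalBasis ℝ (TangentSpace I x) i)‖ ^ 2) := by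
  rw [div_apply_of_apply_eq_zero h.smooth_tensor (mdifferentiableAt_grad h.smooth_potential x)
    fun y v => by rw [h.tensor_symm, hH.apply_grad_eq_zero htr], tr_eq_sum, Finset.mul_sum,
    Finset.mul_sum, ← Finset.sum_add_distrib]
  refine congrArg _ (Finset.sum_congr rfl fun i _ => ?_)
  rw [h.leviCivita_grad, ← inner_sharp, inner_add_right, real_inner_smul_right,
    real_inner_smul_right, real_inner_self_eq_norm_sq]

end QSoliton

theorem proposition3p3 {n : ℕ} {M : Type*} [TopologicalSpace M] [T2Space M]
    [SecondCountableTopology M] [ChartedSpace (EuclideanSpace ℝ (Fin n)) M]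
    [IsManifold (𝓡 n) ∞ M]
    [RiemannianBundle (fun x : M => TangentSpace (𝓡 n) x)]
    [IsContMDiffRiemannianBundle (𝓡 n) ∞ (EuclideanSpace ℝ (Fin n))
      (fun x : M => TangentSpace (𝓡 n) x)]
    (q : Π x : M, TangentSpace (𝓡 n) x →L[ℝ] TangentSpace (𝓡 n) x →L[ℝ] ℝ)
    (lam : ℝ) (f : M → ℝ)
    (hsol : QSoliton.IsGradientSoliton q lam f)
    (hHam : QSoliton.HamiltonIdentity q f)
    (htr : ∀ x y : M, QSoliton.tr q x = QSoliton.tr q y)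
    (hdiv : ∀ x : M, 0 ≤ QSoliton.div q x (QSoliton.grad (𝓡 n) f x))
    (hlam : lam ≠ 0) :
    (0 < lam → ∀ x : M, -2 * lam * n ≤ QSoliton.tr q x ∧ QSoliton.tr q x ≤ 0) ∧
    (lam < 0 → ∀ x : M, 0 ≤ QSoliton.tr q x ∧ QSoliton.tr q x ≤ -2 * lam * n) ∧
    ((∀ x : M, QSoliton.tr q x = 0) → ∀ x : M, q x = 0) ∧
    ((∀ x : M, QSoliton.tr q x = -2 * lam * n) →
      ∀ (x : M) (v w : TangentSpace (𝓡 n) x), q x v w = -2 * lam * inner ℝ v w) := by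
  -- With `c = -2 lam` this is the norm of `Q + 2 lam id`, the tensor that vanishes in the last case;
  -- it serves for the bound of `tr q` by `-2 lam n` as well.
  have hshift := fun x (c : ℝ) => QSoliton.sum_norm_sharp_sub_sq q x c
  simp only [finrank_euclideanSpace_fin] at hshift
  have hN : ∀ x : M,
      ∑ i, ‖QSoliton.sharp (q x) (stdOrthonormalBasis ℝ (TangentSpace (𝓡 n) x) i)‖ ^ 2 ≤
        -2 * lam * QSoliton.tr q x := fun x => by
    have h := hdiv x
    rw [hsol.div_grad hHam htr] at h
    linarith
  have hupper : ∀ x : M, lam * QSoliton.tr q x ≤ 0 := fun x => by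
    have h : 0 ≤ ∑ i,
        ‖QSoliton.sharp (q x) (stdOrthonormalBasis ℝ (TangentSpace (𝓡 n) x) i)‖ ^ 2 := by positivity
    linarith [hN x]
  have hlower : ∀ x : M, 0 ≤ lam * (QSoliton.tr q x - -2 * lam * n) := fun x => by
    have h : 0 ≤ ∑ i,
        ‖QSoliton.sharp (q x) (stdOrthonormalBasis ℝ (TangentSpace (𝓡 n) x) i) -
          (-2 * lam) • stdOrthonormalBasis ℝ (TangentSpace (𝓡 n) x) i‖ ^ 2 := by positivity
    rw [hshift] at h
    linarith [hN x]
  refine ⟨fun hpos x => ⟨?_, ?_⟩, fun hneg x => ⟨?_, ?_⟩, fun h0 x => ?_, fun h0 x v w => ?_⟩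
  · exact sub_nonneg.1 (nonneg_of_mul_nonneg_right (hlower x) hpos)
  · exact nonpos_of_mul_nonpos_right (hupper x) hpos
  · exact nonneg_of_mul_nonpos_right (hupper x) hneg
  · exact sub_nonpos.1 (nonpos_of_mul_nonneg_right (hlower x) hneg)
  · ext v w
    have h := QSoliton.eq_smul_inner_of_sum_norm_sq_nonpos (q := q) (x := x) (c := 0)
      (by rw [hshift, h0]; linarith [hN x, h0 x, congrArg (lam * ·) (h0 x)]) v w
    simpa using h
  · refine QSoliton.eq_smul_inner_of_sum_norm_sq_nonpos ?_ v w
    have h := hN x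
    rw [hshift]
    rw [h0] at h ⊢
    linarith
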